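/- \textbf{Setting.} Let $(S,A,r,P,\rho_0,\gamma)$ be a Markov decision process with bounded $S\subset\mathbb R^{n_1}$ and $A\subset\mathbb R^{n_2}$, bounded measurable reward $r:S\times A\to[R_{\min},R_{\max}]$, transition kernel $P(\cdot\mid s,a)$ and $\gamma\in(0,1]$. Let it be linear with respect to a uniformly continuous feature map $\varphi:S\times A\to\mathbb R^d$ (if $S,A$ are compact, continuity suffices): there are $\theta\in\mathbb R^d$ and finite signed measures $\nu_1,\dots,\nu_d$ on $S$ with $r(s,a)=\langle\varphi(s,a),\theta\rangle$ and $P(\cdot\mid s,a)=\sum_j\varphi_j(s,a)\,\nu_j$. Let $\lambda>0$, $\xi\in(0,1]$ and $V_{\max}\in\mathbb R$. A dataset is a random sequence $D=((s_i,a_i,r(s_i,a_i),s_i'))_{i=1}^N$ that is compliant with the MDP: for each $i$, the conditional law of $s_i'$ given $(s_j,a_j,s_j')_{j<i}$ and $(s_i,a_i)$ is $P(\cdot\mid s_i,a_i)$; the pairs $(s_i,a_i)$ may be chosen in any (even adaptive) way. For measurable $V=V_{t+1}:S\to[-V_{\max},V_{\max}]$ put $BV(s,a)=r(s,a)+\gamma\,\mathbb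 E_{s'\sim P(\cdot\mid s,a)}V(s')$ and let $\hat BV$ be its ridge regression estimate $$\hat BV(s,a)=\varphi(s,a)^\top\Lambda^{-1}\sum_{i=1}^N\varphi(s_i,a_i)\bigl(r(s_i,a_i)+\gamma V(s_i')\bigr),\qquad \Lambda=\sum_{i=1}^N\varphi(s_i,a_i)\varphi(s_i,a_i)^\top+\lambda I .$$ \emph{Grid-Mapping Pseudo-Count.} Fix an integer $\alpha\ge1$ and reals $m\ge1$, $\eta\ge0$. In each coordinate of the state and of the action let $x^{\min},x^{\max}$ be the extreme values in $D$ and $R=x^{\max}-x^{\min}+\eta$. A value $x$ gets the index $\bigl\lfloor \bigl((\alpha(x-x^{\min}))\bmod (mR)\bigr)/R\bigr\rfloor$ (the index is $0$ if $R=0$). The vector of all the indices of $(s,a)$ is its grid cell, and $n'(s,a)$ is the number of $i\le N$ such that $(s_i,a_i)$ has the same grid cell as $(s,a)$. For an integer $T\ge2$ let $u'(s,a)=\sqrt{\ln T/n'(s,a)}$, which is $+\infty$ if $n'(s,a)=0$. \textbf{Theorem 1.} (1) For every $N$ there is a constant $c>0$ such that for all $\alpha\ge1$, $m\ge1$, $\eta\ge0$,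 $T\ge2$, every compliant law of the dataset of size $N$, every such $V$ and every $(s,a)\in S\times A$, $$\mathbb P\bigl(|\hat BV(s,a)-BV(s,a)|\le c\,u'(s,a)\bigr)\ge 1-\xi .$$ (2) There is a constant $C>0$, depending neither on the dataset nor its size nor the grid, such that with $c_N=C\sqrt{\ln(N+2)}$ the following holds. For all $N$, $\eta>0$ and $\varepsilon>0$ there is $\alpha_0$ such that for every $\alpha\ge\max(\alpha_0,1)$ there is $m_0$ such that for all $m\ge\max(m_0,1)$, all $T\ge2$, every compliant law of the dataset of size $N$, every such $V$ and every $(s,a)\in S\times A$, $$\mathbb P\bigl(|\hat BV(s,a)-BV(s,a)|\le c_N\,u'(s,a)+\varepsilon\bigr)\ge 1-\xi .$$ -/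

import Mathlib

open MeasureTheory ProbabilityTheory
open scoped ENNReal Matrix

noncomputable section

/-- A Markov decision process `(S, A, r, P, ρ₀, γ)` whose states and actions are points of `ℝ^n₁` and
`ℝ^n₂`, with bounded measurable reward `r : S × A → [Rmin, Rmax]` and discount `γ ∈ (0, 1]`. -/
structure MDP (n₁ n₂ : ℕ) where
  S : Set (EuclideanSpace ℝ (Fin n₁))
  A : Set (EuclideanSpace ℝ (Fin n₂))
  r : S × A → ℝ
  Rmin : ℝ
  Rmax : ℝ
  measurable_r : Measurable r
  r_mem : ∀ x, r x ∈ Set.Icc Rmin Rmax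
  P : Kernel (S × A) S
  markov : IsMarkovKernel P
  ρ₀ : Measure S
  prob_init : IsProbabilityMeasure ρ₀
  γ : ℝ
  γ_pos : 0 < γ
  γ_le_one : γ ≤ 1

namespace MDP

variable {n₁ n₂ : ℕ} (M : MDP n₁ n₂) {d N : ℕ}

instance : IsMarkovKernel M.P := M.markov

/-- The MDP is linear with respect to the feature map `φ : S × A → ℝ^d`: there are a vector `θ` and
(finite) signed measures `ν₁, …, ν_d` on `S` with `r(s,a) = ⟨φ(s,a), θ⟩` and
`P(B | s,a) = ∑ j, φ_j(s,a) ν_j(B)`. -/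
def IsLinear (φ : M.S × M.A → Fin d → ℝ) : Prop :=
  ∃ (θ : Fin d → ℝ) (ν : Fin d → SignedMeasure M.S),
    (∀ x, M.r x = φ x ⬝ᵥ θ) ∧
    ∀ x, ∀ B : Set M.S, MeasurableSet B → (M.P x).real B = ∑ j, φ x j * ν j B

/-- A static dataset of `N` transitions `((s_i, a_i), s'_i)`; the recorded rewards are
`r(s_i, a_i)`. -/
abbrev Dataset (N : ℕ) : Type := Fin N → (M.S × M.A) × M.S

/-- What is known just before the `i`-th transition is drawn: the transitions recorded earlier,
and the current pair `(s_i, a_i)`. -/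
def history (i : Fin N) (D : M.Dataset N) :
    ({j : Fin N // j < i} → (M.S × M.A) × M.S) × (M.S × M.A) :=
  (fun j => D j, (D i).1)

/-- The law `μ` of the dataset is compliant with the MDP: for every `i`, the conditional law of
`s'_i` given the history is `P(· | s_i, a_i)`. How the pairs `(s_i, a_i)` are chosen is arbitrary
(they may depend on the earlier transitions). -/
def IsCompliant (μ : Measure (M.Dataset N)) : Prop :=
  ∀ i : Fin N,
    μ.map (fun D => (M.history i D, (D i).2)) =
      (μ.map (M.history i)) ⊗ₘ (M.P.comap Prod.snd measurable_snd)

/-- The Bellman operator `(B V)(s,a) = r(s,a) + γ E_{s' ∼ P(·|s,a)} V(s')`. -/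
def bellman (V : M.S → ℝ) (x : M.S × M.A) : ℝ :=
  M.r x + M.γ * ∫ s', V s' ∂(M.P x)

/-- `Λ = ∑ i, φ(s_i,a_i) φ(s_i,a_i)ᵀ + lam • I`. -/
def gram (φ : M.S × M.A → Fin d → ℝ) (lam : ℝ) (D : M.Dataset N) : Matrix (Fin d) (Fin d) ℝ :=
  ∑ i, Matrix.vecMulVec (φ (D i).1) (φ (D i).1) + lam • (1 : Matrix (Fin d) (Fin d) ℝ)

/-- The ridge regression estimate `Λ⁻¹ ∑ i, φ(s_i,a_i) (r(s_i,a_i) + γ V(s'_i))`. -/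
def ridgeWeight (φ : M.S × M.A → Fin d → ℝ) (lam : ℝ) (V : M.S → ℝ) (D : M.Dataset N) :
    Fin d → ℝ :=
  (M.gram φ lam D)⁻¹ *ᵥ ∑ i, (M.r (D i).1 + M.γ * V (D i).2) • φ (D i).1

/-- The empirical Bellman operator estimated from the dataset. -/
def empBellman (φ : M.S × M.A → Fin d → ℝ) (lam : ℝ) (V : M.S → ℝ) (D : M.Dataset N)
    (x : M.S × M.A) : ℝ :=
  φ x ⬝ᵥ M.ridgeWeight φ lam V D

end MDP

/-- `a mod b` for real numbers (with `a mod 0 = a`); it lies in `[0, b)` when `0 < b`. -/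
def realMod (a b : ℝ) : ℝ := a - b * ⌊a / b⌋

/-- Grid index of the number `y` in one coordinate in which the data take the values `z 0, z 1, …`.
With `lo`, `hi` the smallest and largest data value and `R = hi - lo + η`, the number is mapped to
`(α (y - lo)) mod (m R)`, and the index is the integer part of the result in units of `R`. So cells
are half-open intervals of length `R / α`, up to wrap-around at distance `m R / α`. If `R = 0` (then
`η = 0` and the data are constant) all indices are `0`: the coordinate is not gridded. -/
def gridIndex {N : ℕ} (α : ℕ) (m η : ℝ) (z : Fin N → ℝ) (y : ℝ) : ℤ :=
  ⌊realMod (α * (y - ⨅ i, z i)) (m * ((⨆ i, z i) - (⨅ i, z i) + η)) /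
    ((⨆ i, z i) - (⨅ i, z i) + η)⌋

namespace MDP

variable {n₁ n₂ : ℕ} (M : MDP n₁ n₂) {d N : ℕ}

/-- Grid-Mapping: every coordinate of the state and of the action is gridded, using the data range
in that coordinate. -/
def gridCell (α : ℕ) (m η : ℝ) (D : M.Dataset N) (x : M.S × M.A) : (Fin n₁ → ℤ) × (Fin n₂ → ℤ) :=
  (fun k => gridIndex α m η (fun i => (D i).1.1.1 k) (x.1.1 k),
   fun k => gridIndex α m η (fun i => (D i).1.2.1 k) (x.2.1 k))

/-- The pseudo-count `n'(s,a)`: the number of dataset pairs in the grid cell of `(s,a)`. -/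
def pseudoCount (α : ℕ) (m η : ℝ) (D : M.Dataset N) (x : M.S × M.A) : ℕ :=
  (Finset.univ.filter fun i : Fin N => M.gridCell α m η D (D i).1 = M.gridCell α m η D x).card

/-- The uncertainty `u'(s,a) = sqrt (ln T / n'(s,a))`, as an extended number: it is `∞` when
`n'(s,a) = 0` (and `T ≥ 2`). -/
def gpcUncertainty (α : ℕ) (m η : ℝ) (T : ℕ) (D : M.Dataset N) (x : M.S × M.A) : ℝ≥0∞ :=
  (ENNReal.ofReal (Real.log T) / (M.pseudoCount α m η D x : ℝ≥0∞)) ^ (1 / 2 : ℝ)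

/-- `u` is a suitable epistemic uncertainty at level `ξ`: for every `(s,a)`,
`P(|B̂V(s,a) - BV(s,a)| ≤ u(s,a)) ≥ 1 - ξ`, where `P` is the law `μ` of the dataset. -/
def IsUncertaintyQuantifier (φ : M.S × M.A → Fin d → ℝ) (lam : ℝ) (V : M.S → ℝ)
    (μ : Measure (M.Dataset N)) (ξ : ℝ) (u : M.Dataset N → M.S × M.A → ℝ≥0∞) : Prop :=
  ∀ x : M.S × M.A,
    ENNReal.ofReal (1 - ξ) ≤
      μ {D | ENNReal.ofReal |M.empBellman φ lam V D x - M.bellman V x| ≤ u D x}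

end MDP

end

/-! Linearity makes the Bellman image exactly linear, `BV = φ · w`, with `w` bounded uniformly in
`V` (`IsLinear.exists_weight`). With `G` the regularised Gram matrix and `S` the feature-weighted
sum of the sampling noise, the error at `x` is therefore `φ(x)ᵀ G⁻¹ (S - lam w)`.

For a fixed size `N` everything here is bounded surely, while `u'` is at least of order `1/√N`, so
part (1) needs no probability.

For part (2), apply Cauchy–Schwarz in the `G⁻¹` norm. The mean of the features of the `n'` data
points in the cell of `x` has squared norm at most `1/n'` (`inv_regGram_mean_le`). On a fine grid
without harmful wrap-around, uniform continuity puts `φ(x)` close to this mean, and the discrepancy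
is what `ε` pays for. The squared norm of `S` is, up to centred increments, bounded by the growth of
`σ² log det G`. Its expectation is thus `O(log (N + 2))`, and Markov's inequality gives confidence
`1 - ξ` (`selfNormalized_noise_prob`). Since `ξ` is fixed, the resulting factor `1/ξ` is harmless
and no exponential martingale is needed. -/

noncomputable section

/-! ### Quadratic forms of the inverse Gram matrix and the elliptical potential -/

section QuadraticForms

variable {n ι : Type*}

/-- The regularised Gram matrix `∑ i ∈ s, vᵢ vᵢᵀ + lam • 1`. -/
def regGram [DecidableEq n] (lam : ℝ) (v : ι → n → ℝ) (s : Finset ι) : Matrix n n ℝ :=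
  ∑ i ∈ s, Matrix.vecMulVec (v i) (v i) + lam • (1 : Matrix n n ℝ)

theorem regGram_insert [DecidableEq n] [DecidableEq ι] (lam : ℝ) (v : ι → n → ℝ) {s : Finset ι} {a : ι}
    (ha : a ∉ s) :
    regGram lam v (insert a s) = regGram lam v s + Matrix.vecMulVec (v a) (v a) := by
  rw [regGram, regGram, Finset.sum_insert ha]
  abel

variable [Fintype n]

/-- Cauchy–Schwarz for the bilinear form of a positive semidefinite real matrix. -/
theorem Matrix.PosSemidef.sq_dotProduct_mulVec_le {B : Matrix n n ℝ} (hB : B.PosSemidef)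
    (u v : n → ℝ) : (u ⬝ᵥ B *ᵥ v) ^ 2 ≤ (u ⬝ᵥ B *ᵥ u) * (v ⬝ᵥ B *ᵥ v) := by
  have hsymm : v ⬝ᵥ B *ᵥ u = u ⬝ᵥ B *ᵥ v := by
    have hT : Bᵀ = B := by simpa [Matrix.IsSymm] using hB.1
    rw [Matrix.dotProduct_mulVec, ← Matrix.mulVec_transpose, hT, dotProduct_comm]
  -- The form at `u + t v` is a nonnegative quadratic in `t`, so its discriminant is nonpositive.
  have h := discrim_le_zero (a := v ⬝ᵥ B *ᵥ v) (b := 2 * (u ⬝ᵥ B *ᵥ v)) (c := u ⬝ᵥ B *ᵥ u) fun t => by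
    have := hB.dotProduct_mulVec_nonneg (u + t • v)
    simp only [star_trivial, Matrix.mulVec_add, Matrix.mulVec_smul, add_dotProduct, dotProduct_add,
      smul_dotProduct, dotProduct_smul, smul_eq_mul, hsymm] at this
    linarith
  rw [discrim] at h
  linarith

theorem Matrix.PosSemidef.dotProduct_mulVec_add_le {B : Matrix n n ℝ} (hB : B.PosSemidef)
    (u v : n → ℝ) :
    (u + v) ⬝ᵥ B *ᵥ (u + v) ≤ 2 * (u ⬝ᵥ B *ᵥ u) + 2 * (v ⬝ᵥ B *ᵥ v) := by
  have h := hB.dotProduct_mulVec_nonneg (u - v)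
  simp only [star_trivial, Matrix.mulVec_add, Matrix.mulVec_sub, add_dotProduct, sub_dotProduct,
    dotProduct_add, dotProduct_sub] at h ⊢
  linarith

variable [DecidableEq n]

/-- Inversion reverses the order of positive definite real matrices. -/
theorem Matrix.PosDef.dotProduct_inv_mulVec_anti {A B : Matrix n n ℝ} (hA : A.PosDef)
    (hB : B.PosDef) (hAB : ∀ w, w ⬝ᵥ A *ᵥ w ≤ w ⬝ᵥ B *ᵥ w) (v : n → ℝ) :
    v ⬝ᵥ B⁻¹ *ᵥ v ≤ v ⬝ᵥ A⁻¹ *ᵥ v := by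
  have hAv : A *ᵥ (A⁻¹ *ᵥ v) = v := by
    rw [Matrix.mulVec_mulVec, Matrix.mul_nonsing_inv _ hA.det_pos.ne'.isUnit, Matrix.one_mulVec]
  have hBv : B *ᵥ (B⁻¹ *ᵥ v) = v := by
    rw [Matrix.mulVec_mulVec, Matrix.mul_nonsing_inv _ hB.det_pos.ne'.isUnit, Matrix.one_mulVec]
  set w := B⁻¹ *ᵥ v
  set u := A⁻¹ *ᵥ v
  have hT : Aᵀ = A := by simpa [Matrix.IsSymm] using hA.1
  have hsymm : u ⬝ᵥ A *ᵥ w = w ⬝ᵥ v := by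
    rw [Matrix.dotProduct_mulVec, ← Matrix.mulVec_transpose, hT, hAv, dotProduct_comm]
  -- Positivity of `A` at `B⁻¹v - A⁻¹v` reads `2 w·v ≤ w·Aw + u·v`, and the hypothesis gives `w·Aw ≤
  -- w·Bw = w·v`.
  have h := hA.posSemidef.dotProduct_mulVec_nonneg (w - u)
  simp only [star_trivial, Matrix.mulVec_sub, sub_dotProduct, dotProduct_sub, hAv, hsymm] at h
  have hw := hAB w
  rw [hBv] at hw
  rw [dotProduct_comm v w, dotProduct_comm v u]
  linarith

theorem regGram_mulVec (lam : ℝ) (v : ι → n → ℝ) (s : Finset ι) (w : n → ℝ) :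
    regGram lam v s *ᵥ w = ∑ i ∈ s, (v i ⬝ᵥ w) • v i + lam • w := by
  simp [regGram, Matrix.add_mulVec, Matrix.sum_mulVec, Matrix.smul_mulVec,
    Matrix.vecMulVec_mulVec]

theorem dotProduct_regGram_mulVec (lam : ℝ) (v : ι → n → ℝ) (s : Finset ι) (w : n → ℝ) :
    w ⬝ᵥ regGram lam v s *ᵥ w = ∑ i ∈ s, (v i ⬝ᵥ w) ^ 2 + lam * (w ⬝ᵥ w) := by
  rw [regGram_mulVec, dotProduct_add, dotProduct_sum, dotProduct_smul, smul_eq_mul]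
  congr 1
  refine Finset.sum_congr rfl fun i _ => ?_
  rw [dotProduct_smul, smul_eq_mul, dotProduct_comm w, sq]

theorem posDef_regGram {lam : ℝ} (hlam : 0 < lam) (v : ι → n → ℝ) (s : Finset ι) :
    (regGram lam v s).PosDef := by
  refine Matrix.PosDef.posSemidef_add (Matrix.posSemidef_sum _ fun i _ => ?_)
    (Matrix.PosDef.one.smul hlam)
  simpa using Matrix.posSemidef_vecMulVec_self_star (v i)

theorem regGram_mulVec_inv_mulVec {lam : ℝ} (hlam : 0 < lam) (v : ι → n → ℝ) (s : Finset ι)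
    (w : n → ℝ) : regGram lam v s *ᵥ ((regGram lam v s)⁻¹ *ᵥ w) = w := by
  rw [Matrix.mulVec_mulVec,
    Matrix.mul_nonsing_inv _ (posDef_regGram hlam v s).det_pos.ne'.isUnit, Matrix.one_mulVec]

/-- The Gram matrix dominates the one over the empty set, which is `lam • 1`; inversion reverses the
order. -/
theorem inv_regGram_le {lam : ℝ} (hlam : 0 < lam) (v : ι → n → ℝ) (s : Finset ι) (p : n → ℝ) :
    p ⬝ᵥ (regGram lam v s)⁻¹ *ᵥ p ≤ (p ⬝ᵥ p) / lam := by
  have h := (posDef_regGram hlam v ∅).dotProduct_inv_mulVec_anti (posDef_regGram hlam v s)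
    (fun w => by
      rw [dotProduct_regGram_mulVec, dotProduct_regGram_mulVec]
      have : 0 ≤ ∑ i ∈ s, (v i ⬝ᵥ w) ^ 2 := Finset.sum_nonneg fun _ _ => sq_nonneg _
      simpa using this) p
  refine h.trans_eq ?_
  have hp := regGram_mulVec_inv_mulVec hlam v ∅ p
  rw [regGram_mulVec, Finset.sum_empty, zero_add] at hp
  rw [eq_div_iff hlam.ne', mul_comm, ← smul_eq_mul, ← dotProduct_smul, hp]

theorem inv_regGram_nonneg {lam : ℝ} (hlam : 0 < lam) (v : ι → n → ℝ) (s : Finset ι)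
    (p : n → ℝ) : 0 ≤ p ⬝ᵥ (regGram lam v s)⁻¹ *ᵥ p := by
  simpa using (posDef_regGram hlam v s).inv.posSemidef.dotProduct_mulVec_nonneg p

theorem abs_dotProduct_inv_regGram_le {lam : ℝ} (hlam : 0 < lam) (v : ι → n → ℝ) (s : Finset ι)
    (p q : n → ℝ) :
    |p ⬝ᵥ (regGram lam v s)⁻¹ *ᵥ q| ≤
      √(p ⬝ᵥ (regGram lam v s)⁻¹ *ᵥ p) * √(q ⬝ᵥ (regGram lam v s)⁻¹ *ᵥ q) := by
  rw [← Real.sqrt_mul (inv_regGram_nonneg hlam v s p)]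
  exact Real.abs_le_sqrt ((posDef_regGram hlam v s).inv.posSemidef.sq_dotProduct_mulVec_le p q)

/-- The mean of `k` of the feature vectors has squared norm at most `1 / k` with respect to the
inverse of the Gram matrix. -/
theorem inv_regGram_mean_le {lam : ℝ} (hlam : 0 < lam) (v : ι → n → ℝ) {s t : Finset ι}
    (hts : t ⊆ s) (ht : t.Nonempty) :
    ((t.card : ℝ)⁻¹ • ∑ i ∈ t, v i) ⬝ᵥ (regGram lam v s)⁻¹ *ᵥ ((t.card : ℝ)⁻¹ • ∑ i ∈ t, v i) ≤
      1 / t.card := by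
  have hk : (0 : ℝ) < t.card := by exact_mod_cast ht.card_pos
  set p := (t.card : ℝ)⁻¹ • ∑ i ∈ t, v i with hp
  set w := (regGram lam v s)⁻¹ *ᵥ p with hw
  have h1 : p ⬝ᵥ w = w ⬝ᵥ regGram lam v s *ᵥ w := by
    rw [hw, regGram_mulVec_inv_mulVec hlam, ← hw, dotProduct_comm]
  have h2 : (p ⬝ᵥ w) * t.card = ∑ i ∈ t, v i ⬝ᵥ w := by
    rw [hp, smul_dotProduct, sum_dotProduct, smul_eq_mul]
    field_simp
  have h3 : (∑ i ∈ t, v i ⬝ᵥ w) ^ 2 ≤ t.card * ∑ i ∈ t, (v i ⬝ᵥ w) ^ 2 :=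
    sq_sum_le_card_mul_sum_sq
  have h4 : ∑ i ∈ t, (v i ⬝ᵥ w) ^ 2 ≤ p ⬝ᵥ w := by
    rw [h1, dotProduct_regGram_mulVec]
    have : 0 ≤ lam * (w ⬝ᵥ w) := mul_nonneg hlam.le (by
      simpa using dotProduct_star_self_nonneg w)
    have := Finset.sum_le_sum_of_subset_of_nonneg hts
      (f := fun i => (v i ⬝ᵥ w) ^ 2) fun _ _ _ => sq_nonneg _
    linarith
  rw [← h2] at h3
  -- With `k = t.card` and `w = G⁻¹p`, `k² (p·w)² = (∑ vᵢ·w)² ≤ k ∑ (vᵢ·w)² ≤ k (p·w)`, the last sum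
  -- being part of the form of `G` at `w`.
  have h5 : (p ⬝ᵥ w) ^ 2 * t.card ≤ p ⬝ᵥ w := by
    have : t.card * ((p ⬝ᵥ w) ^ 2 * t.card) ≤ t.card * (p ⬝ᵥ w) := by
      nlinarith [mul_le_mul_of_nonneg_left h4 hk.le]
    exact le_of_mul_le_mul_left this hk
  rw [le_div_iff₀ hk]
  by_contra hlt
  push Not at hlt
  have hpos : 0 < p ⬝ᵥ w := by
    by_contra hneg
    nlinarith
  nlinarith

/-- Matrix determinant lemma in the form used for the elliptical potential. -/
theorem inv_regGram_insert_le_log_det [DecidableEq ι] {lam : ℝ} (hlam : 0 < lam) (v : ι → n → ℝ)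
    {s : Finset ι} {a : ι} (ha : a ∉ s) :
    v a ⬝ᵥ (regGram lam v (insert a s))⁻¹ *ᵥ v a ≤
      Real.log (regGram lam v (insert a s)).det - Real.log (regGram lam v s).det := by
  have hpos := (posDef_regGram hlam v s).det_pos
  have hpos' := (posDef_regGram hlam v (insert a s)).det_pos
  set q := v a ⬝ᵥ (regGram lam v (insert a s))⁻¹ *ᵥ v a with hq
  -- Removing the rank-one term multiplies the determinant by `1 - q`; then `log (1 - q) ≤ -q`
  -- concludes.
  have hdet : (regGram lam v s).det = (regGram lam v (insert a s)).det * (1 - q) := by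
    have h := Matrix.det_add_replicateCol_mul_replicateRow (ι := Unit) hpos'.ne'.isUnit
      (-v a) (v a)
    rw [← Matrix.vecMulVec_eq, Matrix.neg_vecMulVec, regGram_insert lam v ha,
      add_neg_cancel_right, ← regGram_insert lam v ha] at h
    rw [h]
    congr 1
    rw [Matrix.det_unique, Matrix.mul_assoc, ← Matrix.replicateCol_mulVec]
    simp only [Matrix.add_apply, Matrix.one_apply_eq, Matrix.replicateRow_mul_replicateCol_apply,
      Matrix.mulVec_neg, dotProduct_neg, ← hq]
    ring
  have hq1 : 0 < 1 - q := by
    rw [hdet] at hpos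
    exact pos_of_mul_pos_right hpos hpos'.le
  rw [hdet, Real.log_mul hpos'.ne' hq1.ne']
  have := Real.log_le_sub_one_of_pos hq1
  linarith

/-- Leibniz expansion with an entrywise bound. The crude factorial is independent of the number of
samples, so the logarithmic growth is kept. -/
theorem log_det_regGram_le {lam L : ℝ} (hlam : 0 < lam) (v : ι → n → ℝ) (s : Finset ι)
    (hv : ∀ i k, |v i k| ≤ L) :
    Real.log (regGram lam v s).det ≤
      Real.log (Fintype.card n).factorial + Fintype.card n * Real.log (lam + s.card * L ^ 2) := by
  have hx : 0 < lam + s.card * L ^ 2 := by positivity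
  have h := Matrix.det_le (A := regGram lam v s) (abv := AbsoluteValue.abs)
    (x := lam + s.card * L ^ 2) fun i j => by
      simp only [AbsoluteValue.abs_apply, regGram, Matrix.add_apply, Matrix.sum_apply,
        Matrix.smul_apply, Matrix.vecMulVec_apply, smul_eq_mul]
      have h1 : |∑ c ∈ s, v c i * v c j| ≤ s.card * L ^ 2 := by
        refine (Finset.abs_sum_le_sum_abs _ _).trans ?_
        rw [← nsmul_eq_mul]
        refine Finset.sum_le_card_nsmul _ _ _ fun c _ => ?_
        rw [abs_mul, sq]
        exact mul_le_mul (hv c i) (hv c j) (abs_nonneg _) ((abs_nonneg _).trans (hv c i))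
      have h2 : |lam * (1 : Matrix n n ℝ) i j| ≤ lam := by
        rw [Matrix.one_apply]
        split_ifs
        · simp [abs_of_pos hlam]
        · simpa using hlam.le
      linarith [abs_add_le (∑ c ∈ s, v c i * v c j) (lam * (1 : Matrix n n ℝ) i j)]
  rw [nsmul_eq_mul, AbsoluteValue.abs_apply] at h
  have hpos := (posDef_regGram hlam v s).det_pos
  have hf : ((Fintype.card n).factorial : ℝ) ≠ 0 := by positivity
  rw [← Real.log_pow, ← Real.log_mul hf (pow_pos hx _).ne']
  exact Real.log_le_log hpos ((le_abs_self _).trans h)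

/-- One step of the self-normalised process. -/
theorem selfNormalized_step [DecidableEq ι] {lam σ : ℝ} (hlam : 0 < lam) (v : ι → n → ℝ)
    (e : ι → ℝ) (he : ∀ i, |e i| ≤ σ) {s : Finset ι} {a : ι} (ha : a ∉ s) :
    (∑ i ∈ insert a s, e i • v i) ⬝ᵥ (regGram lam v (insert a s))⁻¹ *ᵥ
        (∑ i ∈ insert a s, e i • v i) - σ ^ 2 * Real.log (regGram lam v (insert a s)).det ≤
      (∑ i ∈ s, e i • v i) ⬝ᵥ (regGram lam v s)⁻¹ *ᵥ (∑ i ∈ s, e i • v i)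
        - σ ^ 2 * Real.log (regGram lam v s).det
        + 2 * ((v a ⬝ᵥ (regGram lam v (insert a s))⁻¹ *ᵥ (∑ i ∈ s, e i • v i)) * e a) := by
  rw [Finset.sum_insert ha]
  have hG := posDef_regGram hlam v (insert a s)
  have hT : ((regGram lam v (insert a s))⁻¹)ᵀ = (regGram lam v (insert a s))⁻¹ := by
    simpa [Matrix.IsSymm] using hG.inv.1
  set S := ∑ i ∈ s, e i • v i
  have hsymm : S ⬝ᵥ (regGram lam v (insert a s))⁻¹ *ᵥ v a =
      v a ⬝ᵥ (regGram lam v (insert a s))⁻¹ *ᵥ S := by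
    rw [Matrix.dotProduct_mulVec, ← Matrix.mulVec_transpose, hT, dotProduct_comm]
  -- The old sum shrinks in the norm of the larger Gram matrix, and the new square `e a ^ 2` times
  -- the norm of `v a` is paid for by the growth of `log det`. Only the cross term, linear in `e a`,
  -- survives.
  have h1 : S ⬝ᵥ (regGram lam v (insert a s))⁻¹ *ᵥ S ≤ S ⬝ᵥ (regGram lam v s)⁻¹ *ᵥ S := by
    refine (posDef_regGram hlam v s).dotProduct_inv_mulVec_anti hG (fun w => ?_) S
    rw [dotProduct_regGram_mulVec, dotProduct_regGram_mulVec, Finset.sum_insert ha]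
    nlinarith [sq_nonneg (v a ⬝ᵥ w)]
  have h2 := inv_regGram_insert_le_log_det hlam v ha
  have h3 : e a ^ 2 ≤ σ ^ 2 := sq_le_sq' (by linarith [abs_le.1 (he a)]) (abs_le.1 (he a)).2
  have h4 := inv_regGram_nonneg hlam v (insert a s) (v a)
  simp only [Matrix.mulVec_add, Matrix.mulVec_smul, add_dotProduct, dotProduct_add, smul_dotProduct,
    dotProduct_smul, smul_eq_mul, hsymm]
  have h5 := mul_le_mul_of_nonneg_right h3 h4
  have h6 := mul_le_mul_of_nonneg_left h2 (sq_nonneg σ)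
  nlinarith

/-- Telescoping over the initial segments of a finite linear order. -/
theorem Finset.le_add_sum_of_insert_Iio_le [LinearOrder ι] [Fintype ι] [LocallyFiniteOrderBot ι]
    (f : Finset ι → ℝ) (t : ι → ℝ)
    (h : ∀ a, f (insert a (Finset.Iio a)) ≤ f (Finset.Iio a) + t a) :
    f Finset.univ ≤ f ∅ + ∑ a, t a := by
  suffices H : ∀ s : Finset ι, IsLowerSet (s : Set ι) → f s ≤ f ∅ + ∑ a ∈ s, t a from
    H _ (by simpa using isLowerSet_univ)
  intro s
  induction s using Finset.induction_on_max with
  | empty => simp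
  | insert a s hlt ih =>
    intro hs
    have hsa : s = Finset.Iio a := by
      ext b
      refine ⟨fun hb => Finset.mem_Iio.2 (hlt b hb), fun hb => ?_⟩
      have hb' := Finset.mem_Iio.1 hb
      have : b ∈ insert a s := hs hb'.le (by simp)
      exact (Finset.mem_insert.1 this).resolve_left hb'.ne
    have hlow : IsLowerSet (s : Set ι) := by
      rw [hsa, Finset.coe_Iio]
      exact isLowerSet_Iio a
    have ha : a ∉ s := fun hmem => (hlt a hmem).false
    rw [Finset.sum_insert ha]
    have h1 := ih hlow
    have h2 := h a
    rw [← hsa] at h2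
    linarith

/-- The steps telescope from `lam • 1`, whose log-determinant is `card n * log lam`. In the last sum
each `e a` is multiplied by a quantity involving only `v a` and earlier terms, so this sum is
centred for martingale noise. -/
theorem selfNormalized_le [LinearOrder ι] [Fintype ι] [LocallyFiniteOrderBot ι] {lam σ : ℝ}
    (hlam : 0 < lam) (v : ι → n → ℝ) (e : ι → ℝ) (he : ∀ i, |e i| ≤ σ) :
    (∑ i, e i • v i) ⬝ᵥ (regGram lam v Finset.univ)⁻¹ *ᵥ (∑ i, e i • v i) ≤
      σ ^ 2 * (Real.log (regGram lam v Finset.univ).det - Fintype.card n * Real.log lam) +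
        ∑ a, 2 * ((v a ⬝ᵥ (regGram lam v (insert a (Finset.Iio a)))⁻¹ *ᵥ
          (∑ i ∈ Finset.Iio a, e i • v i)) * e a) := by
  have h := Finset.le_add_sum_of_insert_Iio_le (fun s : Finset ι =>
    (∑ i ∈ s, e i • v i) ⬝ᵥ (regGram lam v s)⁻¹ *ᵥ (∑ i ∈ s, e i • v i)
      - σ ^ 2 * Real.log (regGram lam v s).det) _
    fun a => selfNormalized_step hlam v e he (by simp)
  have h0 : Real.log (regGram lam v ∅).det = Fintype.card n * Real.log lam := by
    simp [regGram, Real.log_pow]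
  simp only [h0, Finset.sum_empty, zero_dotProduct] at h
  linarith

end QuadraticForms

end

noncomputable section

/-! ### Deterministic bounds and measurability -/

section Bounds

variable {n ι : Type*}

theorem abs_sum_smul_apply_le {σ L : ℝ} (e : ι → ℝ) (v : ι → n → ℝ) (s : Finset ι)
    (he : ∀ i, |e i| ≤ σ) (hv : ∀ i k, |v i k| ≤ L) (k : n) :
    |(∑ i ∈ s, e i • v i) k| ≤ s.card * (σ * L) := by
  rw [Finset.sum_apply]
  refine (Finset.abs_sum_le_sum_abs _ _).trans ?_
  rw [← nsmul_eq_mul]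
  refine Finset.sum_le_card_nsmul _ _ _ fun i _ => ?_
  rw [Pi.smul_apply, smul_eq_mul, abs_mul]
  exact mul_le_mul (he i) (hv i k) (abs_nonneg _) ((abs_nonneg _).trans (he i))

variable [Fintype n]

theorem dotProduct_self_le {v : n → ℝ} {L : ℝ} (hv : ∀ k, |v k| ≤ L) :
    v ⬝ᵥ v ≤ Fintype.card n * L ^ 2 := by
  rw [dotProduct, ← nsmul_eq_mul]
  refine Finset.sum_le_card_nsmul _ _ _ fun k _ => ?_
  rw [← sq]
  exact sq_le_sq' (by linarith [abs_le.1 (hv k)]) (abs_le.1 (hv k)).2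

variable [DecidableEq n]

theorem abs_dotProduct_inv_regGram_le_of_abs_le {lam La Lb : ℝ} (hlam : 0 < lam) (v : ι → n → ℝ)
    (s : Finset ι) {a b : n → ℝ} (ha : ∀ k, |a k| ≤ La) (hb : ∀ k, |b k| ≤ Lb) :
    |a ⬝ᵥ (regGram lam v s)⁻¹ *ᵥ b| ≤
      √(Fintype.card n * La ^ 2 / lam) * √(Fintype.card n * Lb ^ 2 / lam) := by
  refine (abs_dotProduct_inv_regGram_le hlam v s a b).trans ?_
  gcongr
  · exact (inv_regGram_le hlam v s a).trans (by gcongr; exact dotProduct_self_le ha)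
  · exact (inv_regGram_le hlam v s b).trans (by gcongr; exact dotProduct_self_le hb)

/-- Entries of the inverse are polynomials times `(det A)⁻¹`; as `0⁻¹ = 0` keeps real inversion
measurable, invertibility plays no role. -/
theorem measurable_dotProduct_inv_mulVec {Ω : Type*} [MeasurableSpace Ω] {a b : Ω → n → ℝ}
    {A : Ω → Matrix n n ℝ} (ha : Measurable a) (hb : Measurable b)
    (hA : ∀ k l, Measurable fun ω => A ω k l) :
    Measurable fun ω => a ω ⬝ᵥ (A ω)⁻¹ *ᵥ b ω := by
  have hinv : ∀ k l, Measurable fun ω => (A ω)⁻¹ k l := fun k l => by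
    have hF : Measurable fun B : n → n → ℝ =>
        (Matrix.det (Matrix.of B))⁻¹ * (Matrix.of B).adjugate k l := by
      have hof : Continuous fun B : n → n → ℝ => Matrix.of B := continuous_id
      exact hof.matrix_det.measurable.inv.mul
        (hof.matrix_adjugate.matrix_elem k l).measurable
    have hA' : Measurable fun ω => fun k l => A ω k l :=
      measurable_pi_lambda _ fun k => measurable_pi_lambda _ fun l => hA k l
    convert hF.comp hA' using 1
    funext ω
    simp only [Matrix.inv_def, Ring.inverse_eq_inv', Matrix.smul_apply, smul_eq_mul]
    rfl
  simp only [dotProduct, Matrix.mulVec]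
  refine Finset.measurable_sum _ fun k _ => ((measurable_pi_apply k).comp ha).mul ?_
  exact Finset.measurable_sum _ fun l _ => (hinv k l).mul ((measurable_pi_apply l).comp hb)

end Bounds

/-! ### The regression noise as a martingale difference -/

namespace MDP

variable {n₁ n₂ : ℕ} (M : MDP n₁ n₂) {d N : ℕ}

/-- The deviation of the sampled discounted value from its conditional expectation. -/
def noise (V : M.S → ℝ) (z : (M.S × M.A) × M.S) : ℝ :=
  M.γ * (V z.2 - ∫ s', V s' ∂(M.P z.1))

variable {M}

theorem abs_integral_le {V : M.S → ℝ} {Vmax : ℝ} (hV : ∀ s, |V s| ≤ Vmax) (x : M.S × M.A) :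
    |∫ s', V s' ∂(M.P x)| ≤ Vmax := by
  have h := norm_integral_le_of_norm_le_const (μ := M.P x) (f := V) (C := Vmax)
    (Filter.Eventually.of_forall hV)
  simpa using h

theorem abs_noise_le {V : M.S → ℝ} {Vmax : ℝ} (hV : ∀ s, |V s| ≤ Vmax)
    (z : (M.S × M.A) × M.S) : |M.noise V z| ≤ 2 * Vmax := by
  rw [noise, abs_mul, abs_of_pos M.γ_pos]
  have h1 := abs_sub (V z.2) (∫ s', V s' ∂(M.P z.1))
  have h2 := hV z.2
  have h3 := abs_integral_le hV z.1
  calc M.γ * |V z.2 - ∫ s', V s' ∂(M.P z.1)| ≤ 1 * |V z.2 - ∫ s', V s' ∂(M.P z.1)| :=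
        mul_le_mul_of_nonneg_right M.γ_le_one (abs_nonneg _)
    _ ≤ 2 * Vmax := by linarith

theorem measurable_noise {V : M.S → ℝ} (hV : Measurable V) : Measurable (M.noise V) := by
  have h : Measurable fun x => ∫ s', V s' ∂(M.P x) :=
    hV.stronglyMeasurable.integral_kernel.measurable
  exact ((hV.comp measurable_snd).sub (h.comp measurable_fst)).const_mul _

theorem measurable_history (i : Fin N) : Measurable (M.history i) :=
  (measurable_pi_lambda _ fun _ => measurable_pi_apply _).prodMk
    (measurable_fst.comp (measurable_pi_apply i))

/-- Under a compliant law, a bounded function of the history is orthogonal to the next noise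
term. -/
theorem integral_history_mul_noise {μ : Measure (M.Dataset N)} [IsProbabilityMeasure μ]
    (hμ : M.IsCompliant μ) {V : M.S → ℝ} (hV : Measurable V) {Vmax : ℝ}
    (hVb : ∀ s, |V s| ≤ Vmax) (i : Fin N)
    {g : ({j : Fin N // j < i} → (M.S × M.A) × M.S) × (M.S × M.A) → ℝ} (hg : Measurable g) {K : ℝ}
    (hK : ∀ h, |g h| ≤ K) :
    Integrable (fun D => g (M.history i D) * M.noise V (D i)) μ ∧
      ∫ D, g (M.history i D) * M.noise V (D i) ∂μ = 0 := by
  set F : (({j : Fin N // j < i} → (M.S × M.A) × M.S) × (M.S × M.A)) × M.S → ℝ :=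
    fun q => g q.1 * M.noise V (q.1.2, q.2) with hF
  have hFm : Measurable F := (hg.comp measurable_fst).mul
    ((measurable_noise hV).comp ((measurable_snd.comp measurable_fst).prodMk measurable_snd))
  have hFb : ∀ q, ‖F q‖ ≤ K * (2 * Vmax) := fun q => by
    rw [hF, Real.norm_eq_abs, abs_mul]
    exact mul_le_mul (hK _) (abs_noise_le hVb _) (abs_nonneg _) ((abs_nonneg _).trans (hK q.1))
  have hm : Measurable fun D : M.Dataset N => (M.history i D, (D i).2) :=
    (measurable_history i).prodMk (measurable_snd.comp (measurable_pi_apply i))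
  have hint : ∀ (ρ : Measure ((({j : Fin N // j < i} → (M.S × M.A) × M.S) × (M.S × M.A)) × M.S))
      [IsFiniteMeasure ρ], Integrable F ρ := fun ρ _ =>
    Integrable.of_bound hFm.aestronglyMeasurable _ (Filter.Eventually.of_forall hFb)
  have hprob : IsProbabilityMeasure (μ.map (M.history i)) :=
    Measure.isProbabilityMeasure_map (measurable_history i).aemeasurable
  refine ⟨Integrable.of_bound (C := K * (2 * Vmax)) (hFm.comp hm).aestronglyMeasurable
    (Filter.Eventually.of_forall fun D => hFb (M.history i D, (D i).2)), ?_⟩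
  calc ∫ D, g (M.history i D) * M.noise V (D i) ∂μ
      = ∫ q, F q ∂(μ.map fun D => (M.history i D, (D i).2)) :=
        (integral_map hm.aemeasurable hFm.aestronglyMeasurable).symm
    _ = 0 := by
      -- Compliance lets the next state be integrated first, with the history fixed; the noise then
      -- averages to zero.
      rw [hμ i, Measure.integral_compProd (hint _)]
      refine integral_eq_zero_of_ae (Filter.Eventually.of_forall fun h => ?_)
      have hVi : Integrable V (M.P h.2) :=
        Integrable.of_bound hV.aestronglyMeasurable _ (Filter.Eventually.of_forall hVb)
      simp only [hF, noise, Kernel.comap_apply, integral_const_mul, Pi.zero_apply]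
      rw [integral_sub hVi (integrable_const _)]
      simp

/-- The increments of the self-normalised process are centred. -/
theorem integral_increment_eq_zero {μ : Measure (M.Dataset N)} [IsProbabilityMeasure μ]
    (hμ : M.IsCompliant μ) {V : M.S → ℝ} (hV : Measurable V) {Vmax : ℝ}
    (hVb : ∀ s, |V s| ≤ Vmax) {φ : M.S × M.A → Fin d → ℝ} (hφ : Measurable φ) {L : ℝ}
    (hL : ∀ x k, |φ x k| ≤ L) {lam : ℝ} (hlam : 0 < lam) (i : Fin N) :
    let f : M.Dataset N → ℝ := fun D =>
      (φ (D i).1 ⬝ᵥ (regGram lam (fun j => φ (D j).1) (insert i (Finset.Iio i)))⁻¹ *ᵥ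
        (∑ j ∈ Finset.Iio i, M.noise V (D j) • φ (D j).1)) * M.noise V (D i)
    Integrable f μ ∧ ∫ D, f D ∂μ = 0 := by
  intro f
  -- `none` stands for the current pair and `some j` for an earlier transition, so the Gram matrix
  -- including step `i` becomes a function of the history alone.
  set w : ({j : Fin N // j < i} → (M.S × M.A) × M.S) × (M.S × M.A) →
      Option {j : Fin N // j < i} → Fin d → ℝ :=
    fun h o => o.elim (φ h.2) (fun j => φ (h.1 j).1) with hw
  set S : ({j : Fin N // j < i} → (M.S × M.A) × M.S) × (M.S × M.A) → Fin d → ℝ :=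
    fun h => ∑ j, M.noise V (h.1 j) • φ (h.1 j).1 with hS
  set g : ({j : Fin N // j < i} → (M.S × M.A) × M.S) × (M.S × M.A) → ℝ := fun h =>
    φ h.2 ⬝ᵥ (regGram lam (w h) Finset.univ)⁻¹ *ᵥ S h with hg
  have hwm : ∀ o, Measurable fun h => w h o := by
    rintro (_ | j)
    · exact hφ.comp measurable_snd
    · exact hφ.comp (measurable_fst.comp ((measurable_pi_apply j).comp measurable_fst))
  have hgm : Measurable g := by
    refine measurable_dotProduct_inv_mulVec (hφ.comp measurable_snd) ?_ fun k l => ?_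
    · refine Finset.measurable_sum _ fun j _ => Measurable.fun_smul ?_ (hwm (some j))
      exact (measurable_noise hV).comp ((measurable_pi_apply j).comp measurable_fst)
    · simp only [regGram, Matrix.add_apply, Matrix.sum_apply, Matrix.vecMulVec_apply]
      refine Measurable.add (Finset.measurable_sum _ fun o _ => ?_) measurable_const
      exact ((measurable_pi_apply k).comp (hwm o)).mul ((measurable_pi_apply l).comp (hwm o))
  have hgb := fun h => abs_dotProduct_inv_regGram_le_of_abs_le hlam (w h) Finset.univ (hL h.2)
    (abs_sum_smul_apply_le (fun j => M.noise V (h.1 j)) (fun j => φ (h.1 j).1) Finset.univ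
      (fun j => abs_noise_le hVb _) fun j => hL _)
  have hfg : f = fun D => g (M.history i D) * M.noise V (D i) := by
    funext D
    have hsum : ∀ {E : Type} [AddCommMonoid E] (F : Fin N → E),
        ∑ j ∈ Finset.Iio i, F j = ∑ j : {j : Fin N // j < i}, F j := fun F =>
      Finset.sum_subtype _ (fun j => Finset.mem_Iio) F
    have h1 : regGram lam (fun j => φ (D j).1) (insert i (Finset.Iio i)) =
        regGram lam (w (M.history i D)) Finset.univ := by
      rw [regGram, regGram, Finset.sum_insert (by simp), Fintype.sum_option, hsum]
      rfl
    have h2 : ∑ j ∈ Finset.Iio i, M.noise V (D j) • φ (D j).1 = S (M.history i D) := hsum _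
    simp only [f, h1, h2]
    rfl
  rw [hfg]
  exact integral_history_mul_noise hμ hV hVb i hgm hgb

/-- Self-normalised concentration of the regression noise, at polynomial confidence. -/
theorem selfNormalized_noise_prob {μ : Measure (M.Dataset N)} [IsProbabilityMeasure μ]
    (hμ : M.IsCompliant μ) {V : M.S → ℝ} (hV : Measurable V) {σ Vmax : ℝ}
    (hVb : ∀ s, |V s| ≤ Vmax) (hσ : 2 * Vmax ≤ σ) {φ : M.S × M.A → Fin d → ℝ} (hφ : Measurable φ)
    {L : ℝ} (hL : ∀ x k, |φ x k| ≤ L) {lam : ℝ} (hlam : 0 < lam) {b : ℝ} (hb : 0 < b)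
    (hbound : σ ^ 2 * (Real.log d.factorial + d * Real.log (lam + N * L ^ 2) - d * Real.log lam) ≤ b)
    {ξ : ℝ} (hξ : 0 < ξ) :
    ENNReal.ofReal (1 - ξ) ≤ μ {D | (∑ i, M.noise V (D i) • φ (D i).1) ⬝ᵥ
      (regGram lam (fun i => φ (D i).1) Finset.univ)⁻¹ *ᵥ (∑ i, M.noise V (D i) • φ (D i).1)
        ≤ b / ξ} := by
  set f : Fin N → M.Dataset N → ℝ := fun i D =>
      (φ (D i).1 ⬝ᵥ (regGram lam (fun j => φ (D j).1) (insert i (Finset.Iio i)))⁻¹ *ᵥ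
        (∑ j ∈ Finset.Iio i, M.noise V (D j) • φ (D j).1)) * M.noise V (D i) with hf
  have hfi := fun i => integral_increment_eq_zero hμ hV hVb hφ hL hlam i
  -- `Y` dominates the squared norm `W` pointwise and has mean exactly `b`, its increments being
  -- centred.
  set Y : M.Dataset N → ℝ := fun D => b + ∑ i, 2 * f i D with hY
  set W : M.Dataset N → ℝ := fun D => (∑ i, M.noise V (D i) • φ (D i).1) ⬝ᵥ
      (regGram lam (fun i => φ (D i).1) Finset.univ)⁻¹ *ᵥ (∑ i, M.noise V (D i) • φ (D i).1)
    with hW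
  have hWY : ∀ D, W D ≤ Y D := fun D => by
    have h1 := selfNormalized_le hlam (fun i => φ (D i).1) (fun i => M.noise V (D i))
      (σ := σ) fun i => (abs_noise_le hVb _).trans hσ
    have h2 := log_det_regGram_le hlam (fun i => φ (D i).1) Finset.univ (L := L) fun i => hL _
    simp only [Finset.card_univ, Fintype.card_fin] at h1 h2
    have h3 := mul_le_mul_of_nonneg_left (sub_le_sub_right h2 (d * Real.log lam)) (sq_nonneg σ)
    have h4 := h3.trans hbound
    simp only [hW, hY, hf]
    linarith
  have hW0 : ∀ D, 0 ≤ W D := fun D => inv_regGram_nonneg hlam _ _ _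
  have hsumi : Integrable (fun D => ∑ i, 2 * f i D) μ :=
    integrable_finsetSum _ fun i _ => (hfi i).1.const_mul 2
  have hYi : Integrable Y μ := (integrable_const b).add hsumi
  have hEY : ∫ D, Y D ∂μ = b := by
    rw [hY, integral_add (integrable_const b) hsumi,
      integral_finsetSum _ fun i _ => (hfi i).1.const_mul 2]
    simp only [integral_const_mul]
    rw [Finset.sum_eq_zero fun i _ => by rw [(hfi i).2, mul_zero]]
    simp
  have hmarkov := mul_meas_ge_le_integral_of_nonneg
    (Filter.Eventually.of_forall fun D => (hW0 D).trans (hWY D)) hYi (b / ξ)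
  rw [hEY, div_mul_eq_mul_div, div_le_iff₀ hξ] at hmarkov
  have hbad : μ.real {D | b / ξ ≤ Y D} ≤ ξ := le_of_mul_le_mul_left hmarkov hb
  have hsub : {D | b / ξ ≤ Y D}ᶜ ⊆ {D | W D ≤ b / ξ} := fun D hD =>
    (hWY D).trans (le_of_not_ge hD)
  refine le_trans ?_ (measure_mono hsub)
  have hnull : NullMeasurableSet {D | b / ξ ≤ Y D} μ :=
    nullMeasurableSet_le aemeasurable_const hYi.aemeasurable
  rw [prob_compl_eq_one_sub₀ hnull, ← ofReal_measureReal, ← ENNReal.ofReal_one,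
    ← ENNReal.ofReal_sub _ measureReal_nonneg]
  exact ENNReal.ofReal_le_ofReal (by linarith)

end MDP

end

/-! ### Linearity of the Bellman image and decomposition of the error -/

noncomputable section

/-- Integration against a measure that is a linear combination of differences of finite measures. -/
theorem integral_eq_sum_of_measureReal_eq {Ω ι : Type*} [MeasurableSpace Ω] [Fintype ι]
    {ρ : Measure Ω} [IsFiniteMeasure ρ] (p q : ι → Measure Ω) [∀ j, IsFiniteMeasure (p j)]
    [∀ j, IsFiniteMeasure (q j)] (c : ι → ℝ)
    (h : ∀ B, MeasurableSet B → ρ.real B = ∑ j, c j * ((p j).real B - (q j).real B))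
    {V : Ω → ℝ} (hV : ∀ (κ : Measure Ω) [IsFiniteMeasure κ], Integrable V κ) :
    ∫ ω, V ω ∂ρ = ∑ j, c j * (∫ ω, V ω ∂(p j) - ∫ ω, V ω ∂(q j)) := by
  have hc : ∀ j, ((c j).toNNReal : ℝ) - ((-c j).toNNReal : ℝ) = c j := fun j => by
    rw [Real.coe_toNNReal', Real.coe_toNNReal']
    rcases le_total 0 (c j) with h0 | h0
    · rw [max_eq_left h0, max_eq_right (by linarith)]; ring
    · rw [max_eq_right h0, max_eq_left (by linarith)]; ring
  -- Moving the negative parts of the coefficients to the other side leaves an identity between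
  -- positive measures, which can be integrated.
  have hmeas : ρ + ∑ j, ((c j).toNNReal • q j + (-c j).toNNReal • p j) =
      ∑ j, ((c j).toNNReal • p j + (-c j).toNNReal • q j) := by
    have hsum : ∀ (κ : ι → Measure Ω) [∀ j, IsFiniteMeasure (κ j)] (B : Set Ω),
        (∑ j, κ j).real B = ∑ j, (κ j).real B := fun κ _ B => by
      simp only [measureReal_def, Measure.finsetSum_apply]
      exact ENNReal.toReal_sum fun j _ => measure_ne_top _ _
    ext B hB
    rw [← measureReal_eq_measureReal_iff, measureReal_add_apply, h B hB, hsum, hsum,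
      ← Finset.sum_add_distrib]
    refine Finset.sum_congr rfl fun j _ => ?_
    rw [measureReal_add_apply, measureReal_add_apply]
    simp only [measureReal_nnreal_smul_apply]
    linear_combination ((q j).real B - (p j).real B) * hc j
  have hint := congrArg (fun κ => ∫ ω, V ω ∂κ) hmeas
  beta_reduce at hint
  rw [integral_add_measure (hV _) (hV _), integral_finsetSum_measure fun _ _ => hV _,
    integral_finsetSum_measure fun _ _ => hV _] at hint
  simp only [integral_add_measure (hV _) (hV _), integral_smul_nnreal_measure] at hint
  rw [← eq_sub_iff_add_eq, ← Finset.sum_sub_distrib] at hint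
  rw [hint]
  refine Finset.sum_congr rfl fun j _ => ?_
  simp only [NNReal.smul_def, smul_eq_mul]
  linear_combination (∫ ω, V ω ∂(p j) - ∫ ω, V ω ∂(q j)) * hc j

/-- Bounded sets in proper spaces are totally bounded, and uniformly continuous maps preserve total
boundedness; no closedness is needed. -/
theorem exists_bound_of_uniformContinuous {E F : Type*} [PseudoMetricSpace E] [ProperSpace E]
    [PseudoMetricSpace F] [ProperSpace F] {s : Set E} {t : Set F} (hs : Bornology.IsBounded s)
    (ht : Bornology.IsBounded t) {d : ℕ} {φ : s × t → Fin d → ℝ} (hφ : UniformContinuous φ) :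
    ∃ L : ℝ, 0 ≤ L ∧ ∀ x k, |φ x k| ≤ L := by
  have hind : IsUniformInducing (Prod.map Subtype.val Subtype.val : s × t → E × F) :=
    isUniformEmbedding_subtype_val.isUniformInducing.prod
      isUniformEmbedding_subtype_val.isUniformInducing
  have hst := (hs.prod ht).isCompact_closure.totallyBounded.subset subset_closure
  have h := (totallyBounded_preimage hind hst).image hφ
  obtain ⟨L, hL⟩ := h.isBounded.exists_norm_le
  refine ⟨max L 0, le_max_right _ _, fun x k => ?_⟩
  have h1 := hL (φ x) ⟨x, ⟨x.1.2, x.2.2⟩, rfl⟩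
  exact (norm_le_pi_norm (φ x) k).trans (h1.trans (le_max_left _ _))

namespace MDP

variable {n₁ n₂ : ℕ} {M : MDP n₁ n₂} {d N : ℕ}

/-- In a linear MDP the Bellman image of a bounded function is linear in the features, with
weights bounded uniformly over the function. -/
theorem IsLinear.exists_weight {φ : M.S × M.A → Fin d → ℝ} (hlin : M.IsLinear φ) (Vmax : ℝ) :
    ∃ K : ℝ, 0 ≤ K ∧ ∀ V : M.S → ℝ, Measurable V → (∀ s, |V s| ≤ Vmax) →
      ∃ w : Fin d → ℝ, (∀ k, |w k| ≤ K) ∧ ∀ x, M.bellman V x = φ x ⬝ᵥ w := by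
  obtain ⟨θ, ν, hr, hP⟩ := hlin
  set p := fun j => (ν j).toJordanDecomposition.posPart with hp
  set q := fun j => (ν j).toJordanDecomposition.negPart with hq
  have hpf : ∀ j, IsFiniteMeasure (p j) := fun j =>
    (ν j).toJordanDecomposition.posPart_finite
  have hqf : ∀ j, IsFiniteMeasure (q j) := fun j =>
    (ν j).toJordanDecomposition.negPart_finite
  have hK0 : ∀ j, 0 ≤ |θ j| + (|Vmax| * (p j).real Set.univ + |Vmax| * (q j).real Set.univ) :=
    fun j => by positivity
  -- The total masses of the Jordan parts bound the integrals of every admissible `V`, and `γ ≤ 1`;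
  -- summing over `j` gives one constant for all coordinates.
  refine ⟨∑ j, (|θ j| + (|Vmax| * (p j).real Set.univ + |Vmax| * (q j).real Set.univ)),
    Finset.sum_nonneg fun j _ => hK0 j, fun V hV hVb => ?_⟩
  have hVi : ∀ (κ : Measure M.S) [IsFiniteMeasure κ], Integrable V κ := fun κ _ =>
    Integrable.of_bound hV.aestronglyMeasurable Vmax (Filter.Eventually.of_forall hVb)
  have hVk : ∀ (κ : Measure M.S) [IsFiniteMeasure κ],
      |∫ s, V s ∂κ| ≤ |Vmax| * κ.real Set.univ := fun κ _ => by
    simpa using norm_integral_le_of_norm_le_const (μ := κ) (f := V) (C := |Vmax|)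
      (Filter.Eventually.of_forall fun s => (hVb s).trans (le_abs_self _))
  refine ⟨fun j => θ j + M.γ * (∫ s, V s ∂(p j) - ∫ s, V s ∂(q j)), fun k => ?_, fun x => ?_⟩
  · refine le_trans ?_ (Finset.single_le_sum (fun j _ => hK0 j) (Finset.mem_univ k))
    refine (abs_add_le _ _).trans (add_le_add le_rfl ?_)
    rw [abs_mul, abs_of_pos M.γ_pos]
    calc M.γ * |∫ s, V s ∂(p k) - ∫ s, V s ∂(q k)|
        ≤ 1 * |∫ s, V s ∂(p k) - ∫ s, V s ∂(q k)| :=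
          mul_le_mul_of_nonneg_right M.γ_le_one (abs_nonneg _)
      _ ≤ |∫ s, V s ∂(p k)| + |∫ s, V s ∂(q k)| := by rw [one_mul]; exact abs_sub _ _
      _ ≤ _ := add_le_add (hVk _) (hVk _)
  · have hint := integral_eq_sum_of_measureReal_eq (ρ := M.P x) p q (φ x) (fun B hB => by
      rw [hP x B hB]
      refine Finset.sum_congr rfl fun j _ => ?_
      congr 1
      conv_lhs => rw [← (ν j).toSignedMeasure_toJordanDecomposition]
      rw [JordanDecomposition.toSignedMeasure, Measure.toSignedMeasure_sub_apply hB]) hVi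
    rw [bellman, hr x, hint]
    simp only [dotProduct, mul_add, Finset.sum_add_distrib, Finset.mul_sum]
    congr 1
    refine Finset.sum_congr rfl fun j _ => ?_
    ring

/-- The estimation error is a martingale part plus a regularisation part. -/
theorem empBellman_sub_bellman {φ : M.S × M.A → Fin d → ℝ} {lam : ℝ} (hlam : 0 < lam)
    {V : M.S → ℝ} {w : Fin d → ℝ} (hw : ∀ x, M.bellman V x = φ x ⬝ᵥ w) (D : M.Dataset N)
    (x : M.S × M.A) :
    M.empBellman φ lam V D x - M.bellman V x =
      φ x ⬝ᵥ (regGram lam (fun i => φ (D i).1) Finset.univ)⁻¹ *ᵥ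
        (∑ i, M.noise V (D i) • φ (D i).1 - lam • w) := by
  set G := regGram lam (fun i => φ (D i).1) Finset.univ with hG
  have hsum : ∑ i, (M.r (D i).1 + M.γ * V (D i).2) • φ (D i).1 =
      (∑ i, M.noise V (D i) • φ (D i).1 - lam • w) + G *ᵥ w := by
    have hy : ∀ i, (M.r (D i).1 + M.γ * V (D i).2) • φ (D i).1 =
        M.noise V (D i) • φ (D i).1 + (φ (D i).1 ⬝ᵥ w) • φ (D i).1 := fun i => by
      rw [← add_smul, ← hw, bellman, noise]
      congr 1
      ring
    rw [hG, regGram_mulVec]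
    simp only [hy, Finset.sum_add_distrib]
    abel
  have hinv : G⁻¹ *ᵥ (G *ᵥ w) = w := by
    rw [Matrix.mulVec_mulVec, Matrix.nonsing_inv_mul _ (posDef_regGram hlam _ _).det_pos.ne'.isUnit,
      Matrix.one_mulVec]
  have hgram : M.gram φ lam D = G := rfl
  rw [empBellman, ridgeWeight, hgram, hsum, Matrix.mulVec_add, hinv, dotProduct_add, hw]
  ring

/-- Holds for every dataset: each coordinate of the noise sum is at most `N σ L`. The growth in `N`
is why this serves only a fixed size. -/
theorem abs_empBellman_sub_bellman_le {φ : M.S × M.A → Fin d → ℝ} {lam : ℝ} (hlam : 0 < lam)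
    {V : M.S → ℝ} {w : Fin d → ℝ} (hw : ∀ x, M.bellman V x = φ x ⬝ᵥ w) {σ K L : ℝ}
    (hwK : ∀ k, |w k| ≤ K) (hL : ∀ x k, |φ x k| ≤ L) (hσ : ∀ z, |M.noise V z| ≤ σ)
    (D : M.Dataset N) (x : M.S × M.A) :
    |M.empBellman φ lam V D x - M.bellman V x| ≤
      √(d * L ^ 2 / lam) * √(d * (N * (σ * L) + lam * K) ^ 2 / lam) := by
  rw [empBellman_sub_bellman hlam hw]
  refine (abs_dotProduct_inv_regGram_le_of_abs_le hlam _ _ (hL x) fun k => ?_).trans_eq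
    (by rw [Fintype.card_fin])
  have h1 := abs_sum_smul_apply_le (fun i => M.noise V (D i)) (fun i => φ (D i).1) Finset.univ
    (fun i => hσ _) (fun i => hL _) k
  simp only [Finset.card_univ, Fintype.card_fin] at h1
  have h2 : |(lam • w) k| ≤ lam * K := by
    rw [Pi.smul_apply, smul_eq_mul, abs_mul, abs_of_pos hlam]
    exact mul_le_mul_of_nonneg_left (hwK k) hlam.le
  rw [Pi.sub_apply]
  exact (abs_sub _ _).trans (add_le_add h1 h2)

/-- Error bound at a point whose features are `δ`-close to those of the dataset pairs in a
nonempty index set `J`. -/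
theorem abs_empBellman_sub_bellman_le_of_close {φ : M.S × M.A → Fin d → ℝ} {lam : ℝ}
    (hlam : 0 < lam) {V : M.S → ℝ} {w : Fin d → ℝ} (hw : ∀ x, M.bellman V x = φ x ⬝ᵥ w)
    {K δ t : ℝ} (hwK : ∀ k, |w k| ≤ K) (D : M.Dataset N) (x : M.S × M.A) {J : Finset (Fin N)}
    (hJ : J.Nonempty) (hclose : ∀ i ∈ J, ∀ k, |φ x k - φ (D i).1 k| ≤ δ)
    (ht : (∑ i, M.noise V (D i) • φ (D i).1) ⬝ᵥ
      (regGram lam (fun i => φ (D i).1) Finset.univ)⁻¹ *ᵥ (∑ i, M.noise V (D i) • φ (D i).1) ≤ t) :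
    |M.empBellman φ lam V D x - M.bellman V x| ≤
      (√(1 / J.card) + √(d * δ ^ 2 / lam)) * √(2 * t + 2 * (lam * (d * K ^ 2))) := by
  rw [empBellman_sub_bellman hlam hw]
  set v : Fin N → Fin d → ℝ := fun i => φ (D i).1 with hv
  set S := ∑ i, M.noise V (D i) • v i
  set z := S - lam • w with hz
  set p := (J.card : ℝ)⁻¹ • ∑ i ∈ J, v i with hp
  have hk : (0 : ℝ) < J.card := by exact_mod_cast hJ.card_pos
  have hzz : z ⬝ᵥ (regGram lam v Finset.univ)⁻¹ *ᵥ z ≤ 2 * t + 2 * (lam * (d * K ^ 2)) := by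
    rw [hz, sub_eq_add_neg, ← neg_smul]
    refine ((posDef_regGram hlam v _).inv.posSemidef.dotProduct_mulVec_add_le _ _).trans ?_
    have h1 : ((-lam) • w) ⬝ᵥ (regGram lam v Finset.univ)⁻¹ *ᵥ ((-lam) • w) ≤
        lam * (d * K ^ 2) := by
      refine (inv_regGram_le hlam v _ _).trans ?_
      rw [smul_dotProduct, dotProduct_smul, smul_eq_mul, smul_eq_mul, ← mul_assoc, neg_mul_neg,
        mul_assoc, mul_div_cancel_left₀ _ hlam.ne']
      have := dotProduct_self_le hwK
      rw [Fintype.card_fin] at this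
      exact mul_le_mul_of_nonneg_left this hlam.le
    linarith
  have he : ∀ k, |(φ x - p) k| ≤ δ := fun k => by
    have h1 : (φ x - p) k = (J.card : ℝ)⁻¹ * ∑ i ∈ J, (φ x k - v i k) := by
      rw [hp, Pi.sub_apply, Pi.smul_apply, Finset.sum_apply, Finset.sum_sub_distrib,
        Finset.sum_const, nsmul_eq_mul, smul_eq_mul]
      field_simp
    rw [h1, abs_mul, abs_of_pos (inv_pos.2 hk), inv_mul_le_iff₀ hk, ← nsmul_eq_mul]
    exact (Finset.abs_sum_le_sum_abs _ _).trans
      (Finset.sum_le_card_nsmul _ _ _ fun i hi => hclose i hi k)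
  -- The mean `p` over `J` has norm at most `√(1 / J.card)`; the remainder has coordinates at most
  -- `δ`, and `G⁻¹ ≤ lam⁻¹` controls it.
  have hsplit : φ x ⬝ᵥ (regGram lam v Finset.univ)⁻¹ *ᵥ z =
      p ⬝ᵥ (regGram lam v Finset.univ)⁻¹ *ᵥ z +
        (φ x - p) ⬝ᵥ (regGram lam v Finset.univ)⁻¹ *ᵥ z := by
    rw [sub_dotProduct]
    ring
  rw [hsplit, add_mul]
  refine (abs_add_le _ _).trans (add_le_add ?_ ?_)
  · refine (abs_dotProduct_inv_regGram_le hlam v _ _ _).trans ?_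
    gcongr
    exact inv_regGram_mean_le hlam v (Finset.subset_univ _) hJ
  · refine (abs_dotProduct_inv_regGram_le hlam v _ _ _).trans ?_
    gcongr
    refine (inv_regGram_le hlam v _ _).trans ?_
    have := dotProduct_self_le he
    rw [Fintype.card_fin] at this
    gcongr

end MDP

end

/-! ### Geometry of the grid -/

noncomputable section

theorem realMod_of_nonneg_of_lt {a b : ℝ} (ha : 0 ≤ a) (hab : a < b) : realMod a b = a := by
  have hb : 0 < b := ha.trans_lt hab
  have : ⌊a / b⌋ = 0 := Int.floor_eq_zero_iff.2 ⟨div_nonneg ha hb.le, (div_lt_one hb).2 hab⟩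
  simp [realMod, this]

theorem realMod_of_neg_of_le {a b : ℝ} (ha : a < 0) (hab : -b ≤ a) : realMod a b = a + b := by
  have hb : 0 < b := by linarith
  have : ⌊a / b⌋ = -1 := by
    rw [Int.floor_eq_iff]
    push_cast
    refine ⟨by rw [le_div_iff₀ hb]; linarith, ?_⟩
    simpa using div_neg_of_neg_of_pos ha hb
  simp [realMod, this]

/-- Without wrap-around, numbers with the same grid index are close. -/
theorem abs_sub_le_of_gridIndex_eq {N : ℕ} {α : ℕ} {m η c y : ℝ} {z : Fin N → ℝ} {i : Fin N}
    (hα : 1 ≤ α) (hη : 0 < η) (hm : α + 1 + α * c / η ≤ m) (hy : ∀ j, |y - z j| ≤ c)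
    (hz : ∀ j k, |z j - z k| ≤ c) (h : gridIndex α m η z (z i) = gridIndex α m η z y) :
    |y - z i| ≤ (c + η) / α := by
  have hN : Nonempty (Fin N) := ⟨i⟩
  obtain ⟨j₀, hj₀⟩ := exists_eq_ciInf_of_finite (f := z)
  obtain ⟨j₁, hj₁⟩ := exists_eq_ciSup_of_finite (f := z)
  have hlo : z j₀ ≤ z i := hj₀ ▸ ciInf_le (Set.finite_range z).bddBelow i
  have hhi : z i ≤ z j₁ := hj₁ ▸ le_ciSup (Set.finite_range z).bddAbove i
  have hα' : (1 : ℝ) ≤ α := by exact_mod_cast hα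
  have hc : 0 ≤ c := (abs_nonneg _).trans (hy i)
  rw [gridIndex, gridIndex, ← hj₀, ← hj₁] at h
  set R := z j₁ - z j₀ + η with hR
  have hηR : η ≤ R := by linarith
  have hRpos : 0 < R := hη.trans_le hηR
  have hRc : R ≤ c + η := by linarith [(abs_le.1 (hz j₁ j₀)).2]
  -- One period `m R` exceeds `α c` by at least `(α + 1) R`, so points to the right of the data
  -- minimum do not wrap around.
  have hαc : α * c ≤ (m - α - 1) * R := by
    have h1 : α * c / η ≤ m - α - 1 := by linarith
    rw [div_le_iff₀ hη] at h1
    have h0 : 0 ≤ α * c / η := by positivity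
    exact h1.trans (mul_le_mul_of_nonneg_left hηR (by linarith))
  have hzi : α * (z i - z j₀) ≤ α * R := by
    gcongr
    linarith
  rw [realMod_of_nonneg_of_lt (a := α * (z i - z j₀)) (by
    have := sub_nonneg.2 hlo
    positivity) (by nlinarith)] at h
  have hyj := abs_le.1 (hy j₀)
  have hys : α * (y - z j₀) ≤ α * c := mul_le_mul_of_nonneg_left hyj.2 (by positivity)
  have hys' : -(α * c) ≤ α * (y - z j₀) := by
    rw [← mul_neg]
    exact mul_le_mul_of_nonneg_left hyj.1 (by positivity)
  rcases le_or_gt 0 (y - z j₀) with hpos | hneg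
  · rw [realMod_of_nonneg_of_lt (a := α * (y - z j₀)) (by positivity) (by nlinarith)] at h
    have h1 := Int.abs_sub_lt_one_of_floor_eq_floor h
    rw [← sub_div, abs_div, abs_of_pos hRpos, div_lt_one hRpos, ← mul_sub, abs_mul,
      abs_of_pos (by linarith : (0 : ℝ) < α), sub_sub_sub_cancel_right, abs_sub_comm] at h1
    rw [le_div_iff₀ (by linarith), mul_comm]
    linarith
  -- A point to the left of all data wraps to an index at least `α + 1`, whereas data points have
  -- index at most `α`.
  · exfalso
    have hneg' : α * (y - z j₀) < 0 := mul_neg_of_pos_of_neg (by linarith) hneg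
    rw [realMod_of_neg_of_le hneg' (by nlinarith)] at h
    have h1 : (⌊α * (z i - z j₀) / R⌋ : ℝ) ≤ α :=
      (Int.floor_le _).trans ((div_le_iff₀ hRpos).2 hzi)
    have h2 : (α : ℝ) + 1 ≤ ⌊(α * (y - z j₀) + m * R) / R⌋ := by
      have : ((α + 1 : ℤ)) ≤ ⌊(α * (y - z j₀) + m * R) / R⌋ := by
        rw [Int.le_floor]
        push_cast
        rw [le_div_iff₀ hRpos]
        nlinarith
      exact_mod_cast this
    rw [← h] at h2
    linarith

theorem EuclideanSpace.dist_le_sqrt_mul {n : ℕ} {x y : EuclideanSpace ℝ (Fin n)} {c : ℝ}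
    (hc : 0 ≤ c) (h : ∀ k, |x k - y k| ≤ c) : dist x y ≤ √n * c := by
  rw [EuclideanSpace.dist_eq, ← Real.sqrt_sq hc, ← Real.sqrt_mul (Nat.cast_nonneg _)]
  refine Real.sqrt_le_sqrt ?_
  have := Finset.sum_le_card_nsmul Finset.univ (fun k => dist (x k) (y k) ^ 2) (c ^ 2) fun k _ => by
    rw [Real.dist_eq]
    exact pow_le_pow_left₀ (abs_nonneg _) (h k) 2
  simpa using this

theorem EuclideanSpace.abs_sub_apply_le_dist {n : ℕ} (x y : EuclideanSpace ℝ (Fin n)) (k : Fin n) :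
    |x k - y k| ≤ dist x y := by
  rw [dist_eq_norm]
  exact PiLp.norm_apply_le (x - y) k

namespace MDP

variable {n₁ n₂ : ℕ} {M : MDP n₁ n₂} {d N : ℕ}

/-- For a fine grid with few wrap-arounds, pairs in the same cell have close features. -/
theorem exists_grid_features_close (hS : Bornology.IsBounded M.S) (hA : Bornology.IsBounded M.A)
    {φ : M.S × M.A → Fin d → ℝ} (hφ : UniformContinuous φ) {η : ℝ} (hη : 0 < η) {δ : ℝ}
    (hδ : 0 < δ) :
    ∃ α₀ : ℕ, ∀ α : ℕ, α₀ ≤ α → 1 ≤ α → ∃ m₀ : ℝ, ∀ m : ℝ, m₀ ≤ m →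
      ∀ (N : ℕ) (D : M.Dataset N) (x : M.S × M.A) (i : Fin N),
        M.gridCell α m η D (D i).1 = M.gridCell α m η D x →
          ∀ k, |φ x k - φ (D i).1 k| ≤ δ := by
  obtain ⟨τ, hτ, hφτ⟩ := Metric.uniformContinuous_iff.1 hφ δ hδ
  obtain ⟨c₁, hc₁⟩ := Metric.isBounded_iff.1 hS
  obtain ⟨c₂, hc₂⟩ := Metric.isBounded_iff.1 hA
  -- `c` bounds the coordinate spread of `M.S` and `M.A`, hence of any dataset, so the thresholds
  -- depend on neither `N` nor `D`.
  set c := max (max c₁ c₂) 0 with hc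
  have hc0 : 0 ≤ c := le_max_right _ _
  have hdS : ∀ (s t : M.S) k, |s.1 k - t.1 k| ≤ c := fun s t k =>
    (EuclideanSpace.abs_sub_apply_le_dist _ _ k).trans
      ((hc₁ s.2 t.2).trans ((le_max_left _ _).trans (le_max_left _ _)))
  have hdA : ∀ (s t : M.A) k, |s.1 k - t.1 k| ≤ c := fun s t k =>
    (EuclideanSpace.abs_sub_apply_le_dist _ _ k).trans
      ((hc₂ s.2 t.2).trans ((le_max_right _ _).trans (le_max_left _ _)))
  obtain ⟨α₀, hα₀⟩ := exists_nat_gt ((√n₁ + √n₂) * (c + η) / τ)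
  refine ⟨α₀, fun α hα hα1 => ⟨α + 1 + α * c / η, fun m hm N D x i hcell k => ?_⟩⟩
  have hα' : (0 : ℝ) < α := by exact_mod_cast hα1
  have hfine : (√n₁ + √n₂) * ((c + η) / α) < τ := by
    have h1 : (√n₁ + √n₂) * (c + η) / τ < α := hα₀.trans_le (by exact_mod_cast hα)
    rw [div_lt_iff₀ hτ] at h1
    rw [← mul_div_assoc, div_lt_iff₀ hα']
    linarith
  have hcα : 0 ≤ (c + η) / α := by positivity
  have h1 : dist x.1.1 (D i).1.1.1 ≤ √n₁ * ((c + η) / α) :=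
    EuclideanSpace.dist_le_sqrt_mul hcα fun k =>
      abs_sub_le_of_gridIndex_eq (z := fun i => (D i).1.1.1 k) hα1 hη hm (fun j => hdS _ _ k)
        (fun j l => hdS _ _ k) (congrFun (congrArg Prod.fst hcell) k)
  have h2 : dist x.2.1 (D i).1.2.1 ≤ √n₂ * ((c + η) / α) :=
    EuclideanSpace.dist_le_sqrt_mul hcα fun k =>
      abs_sub_le_of_gridIndex_eq (z := fun i => (D i).1.2.1 k) hα1 hη hm (fun j => hdA _ _ k)
        (fun j l => hdA _ _ k) (congrFun (congrArg Prod.snd hcell) k)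
  have hdist : dist x (D i).1 < τ := by
    rw [Prod.dist_eq, Subtype.dist_eq, Subtype.dist_eq, max_lt_iff]
    have := mul_nonneg (Real.sqrt_nonneg n₁) hcα
    have := mul_nonneg (Real.sqrt_nonneg n₂) hcα
    constructor <;> linarith
  exact (dist_le_pi_dist (φ x) (φ (D i).1) k).trans (hφτ hdist).le

theorem gpcUncertainty_eq_top {α : ℕ} {m η : ℝ} {T : ℕ} (hT : 2 ≤ T) {D : M.Dataset N}
    {x : M.S × M.A} (h : M.pseudoCount α m η D x = 0) : M.gpcUncertainty α m η T D x = ∞ := by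
  have hlog : ENNReal.ofReal (Real.log T) ≠ 0 := by
    simpa using Real.log_pos (by exact_mod_cast hT : (1 : ℝ) < T)
  rw [gpcUncertainty, h, Nat.cast_zero, ENNReal.div_zero hlog,
    ENNReal.top_rpow_of_pos (by norm_num)]

theorem gpcUncertainty_eq_ofReal {α : ℕ} {m η : ℝ} {T : ℕ} (hT : 2 ≤ T) {D : M.Dataset N}
    {x : M.S × M.A} (h : M.pseudoCount α m η D x ≠ 0) :
    M.gpcUncertainty α m η T D x =
      ENNReal.ofReal √(Real.log T / M.pseudoCount α m η D x) := by
  have hk : (0 : ℝ) < M.pseudoCount α m η D x := by exact_mod_cast Nat.pos_of_ne_zero h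
  have hlog : 0 ≤ Real.log T := Real.log_nonneg (by exact_mod_cast (by omega : 1 ≤ T))
  rw [gpcUncertainty, ← ENNReal.ofReal_natCast, ← ENNReal.ofReal_div_of_pos hk,
    ENNReal.ofReal_rpow_of_nonneg (by positivity) (by norm_num), Real.sqrt_eq_rpow]

/-- Replacing `T` by its least value 2 makes the constants independent of `T`. -/
theorem ofReal_sqrt_le_gpcUncertainty {α : ℕ} {m η : ℝ} {T : ℕ} (hT : 2 ≤ T) {D : M.Dataset N}
    {x : M.S × M.A} (h : M.pseudoCount α m η D x ≠ 0) :
    ENNReal.ofReal √(Real.log 2 / M.pseudoCount α m η D x) ≤ M.gpcUncertainty α m η T D x := by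
  rw [gpcUncertainty_eq_ofReal hT h]
  gcongr
  exact_mod_cast hT

end MDP

end

/-! ### Assembling the two bounds -/

noncomputable section

namespace MDP

variable {n₁ n₂ : ℕ} {M : MDP n₁ n₂} {d N : ℕ}

/-- For a fixed dataset size the estimation error is deterministically bounded, hence bounded by a
multiple of the pseudo-count uncertainty, which is at least `√(ln 2 / N)`. -/
theorem exists_uncertaintyQuantifier_of_size {φ : M.S × M.A → Fin d → ℝ} (hlin : M.IsLinear φ)
    {L : ℝ} (hL : ∀ x k, |φ x k| ≤ L) {lam : ℝ} (hlam : 0 < lam) {ξ : ℝ} (hξ : 0 ≤ ξ) (Vmax : ℝ)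
    (N : ℕ) :
    ∃ c : ℝ, 0 < c ∧ ∀ (α : ℕ) (m η : ℝ) (T : ℕ), 2 ≤ T →
      ∀ μ : Measure (M.Dataset N), IsProbabilityMeasure μ →
      ∀ V : M.S → ℝ, Measurable V → (∀ s, |V s| ≤ Vmax) →
        M.IsUncertaintyQuantifier φ lam V μ ξ
          (fun D x => ENNReal.ofReal c * M.gpcUncertainty α m η T D x) := by
  obtain ⟨K, -, hK⟩ := hlin.exists_weight Vmax
  set E := √(d * L ^ 2 / lam) * √(d * (N * (2 * Vmax * L) + lam * K) ^ 2 / lam) with hE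
  have hE0 : 0 ≤ E := by positivity
  have hlog2 : 0 < Real.log 2 := Real.log_pos one_lt_two
  -- `N + 1` keeps the denominator of `c` nonzero for an empty dataset, and `E + 1` keeps `c`
  -- positive.
  have hs : 0 < √(Real.log 2 / (N + 1)) := by positivity
  have hc : 0 < (E + 1) / √(Real.log 2 / (N + 1)) := by positivity
  refine ⟨_, hc, fun α m η T hT μ hμ V hV hVb x => ?_⟩
  obtain ⟨w, hwK, hw⟩ := hK V hV hVb
  have huniv : {D : M.Dataset N | ENNReal.ofReal |M.empBellman φ lam V D x - M.bellman V x| ≤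
      ENNReal.ofReal ((E + 1) / √(Real.log 2 / (N + 1))) * M.gpcUncertainty α m η T D x} =
      Set.univ := by
    refine Set.eq_univ_of_forall fun D => ?_
    rw [Set.mem_ofPred_eq]
    rcases eq_or_ne (M.pseudoCount α m η D x) 0 with h0 | h0
    · rw [gpcUncertainty_eq_top hT h0, ENNReal.mul_top (by simpa using hc)]
      exact le_top
    · refine le_trans ?_ (mul_le_mul_right (ofReal_sqrt_le_gpcUncertainty hT h0) _)
      rw [← ENNReal.ofReal_mul hc.le]
      refine ENNReal.ofReal_le_ofReal ?_
      have hcard : (M.pseudoCount α m η D x : ℝ) ≤ N + 1 := by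
        have : M.pseudoCount α m η D x ≤ N := by
          simpa [pseudoCount] using Finset.card_filter_le (Finset.univ : Finset (Fin N)) _
        exact_mod_cast this.trans (Nat.le_succ N)
      have hpos : (0 : ℝ) < M.pseudoCount α m η D x := by exact_mod_cast Nat.pos_of_ne_zero h0
      calc |M.empBellman φ lam V D x - M.bellman V x|
          ≤ E := abs_empBellman_sub_bellman_le hlam hw hwK hL (abs_noise_le hVb) D x
        _ ≤ (E + 1) / √(Real.log 2 / (N + 1)) * √(Real.log 2 / (N + 1)) := by
          rw [div_mul_cancel₀ _ hs.ne']
          linarith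
        _ ≤ _ := by gcongr
  rw [huniv, measure_univ]
  exact ENNReal.ofReal_le_one.2 (by linarith)

/-- The elliptical potential grows at most logarithmically in the size of the dataset. -/
theorem exists_potential_le_log (d : ℕ) {σ lam L : ℝ} (hσ : 0 < σ) (hlam : 0 < lam) :
    ∃ b₀ : ℝ, 0 < b₀ ∧ ∀ N : ℕ,
      σ ^ 2 * (Real.log d.factorial + d * Real.log (lam + N * L ^ 2) - d * Real.log lam) ≤
        b₀ * Real.log (N + 2) := by
  have hlog2 : 0 < Real.log 2 := Real.log_pos one_lt_two
  have hfact : 0 ≤ Real.log d.factorial :=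
    Real.log_nonneg (by exact_mod_cast Nat.one_le_iff_ne_zero.2 d.factorial_ne_zero)
  set A := Real.log d.factorial + d * |Real.log (lam + L ^ 2)| + d * |Real.log lam| with hA
  have hA0 : 0 ≤ A := by positivity
  -- `A / log 2` absorbs the constants because `log (N + 2) ≥ log 2`; `d` comes from `lam + N L² ≤
  -- (lam + L²)(N + 2)`; the `1` ensures positivity.
  refine ⟨σ ^ 2 * (A / Real.log 2 + d + 1), by positivity, fun N => ?_⟩
  have hN2 : (0 : ℝ) < N + 2 := by positivity
  have hℓ : Real.log 2 ≤ Real.log (N + 2) :=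
    Real.log_le_log two_pos (by linarith [(Nat.cast_nonneg N : (0 : ℝ) ≤ N)])
  have h1 : Real.log (lam + N * L ^ 2) ≤ Real.log (lam + L ^ 2) + Real.log (N + 2) := by
    rw [← Real.log_mul (by positivity) hN2.ne']
    refine Real.log_le_log (by positivity) ?_
    have : (0 : ℝ) ≤ N * lam := by positivity
    nlinarith [sq_nonneg L]
  have h2 : A ≤ A / Real.log 2 * Real.log (N + 2) := by
    rw [div_mul_eq_mul_div, le_div_iff₀ hlog2]
    exact mul_le_mul_of_nonneg_left hℓ hA0
  rw [mul_assoc]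
  refine mul_le_mul_of_nonneg_left ?_ (sq_nonneg σ)
  have hd : (0 : ℝ) ≤ d := Nat.cast_nonneg d
  have h3 := mul_le_mul_of_nonneg_left (h1.trans (add_le_add_left (le_abs_self _) _)) hd
  have h4 := mul_le_mul_of_nonneg_left (neg_le_abs (Real.log lam)) hd
  have h5 : 0 ≤ Real.log (N + 2) := hlog2.le.trans hℓ
  nlinarith

/-- With a fine grid, the pseudo-count uncertainty quantifies the estimation error at rate
`√(ln (N + 2))`, up to an arbitrarily small additive error. -/
theorem exists_uncertaintyQuantifier_of_fine_grid (hS : Bornology.IsBounded M.S)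
    (hA : Bornology.IsBounded M.A) {φ : M.S × M.A → Fin d → ℝ} (hlin : M.IsLinear φ)
    (hφ : UniformContinuous φ) {L : ℝ} (hL : ∀ x k, |φ x k| ≤ L) {lam : ℝ} (hlam : 0 < lam)
    {ξ : ℝ} (hξ : 0 < ξ) (Vmax : ℝ) :
    ∃ C : ℝ, 0 < C ∧ ∀ N : ℕ, ∀ η : ℝ, 0 < η → ∀ ε : ℝ, 0 < ε →
      ∃ α₀ : ℕ, ∀ α : ℕ, α₀ ≤ α → 1 ≤ α → ∃ m₀ : ℝ, ∀ m : ℝ, m₀ ≤ m →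
      ∀ T : ℕ, 2 ≤ T → ∀ μ : Measure (M.Dataset N), IsProbabilityMeasure μ → M.IsCompliant μ →
      ∀ V : M.S → ℝ, Measurable V → (∀ s, |V s| ≤ Vmax) →
        M.IsUncertaintyQuantifier φ lam V μ ξ
          (fun D x => ENNReal.ofReal (C * √(Real.log (N + 2))) *
            M.gpcUncertainty α m η T D x + ENNReal.ofReal ε) := by
  obtain ⟨K, -, hK⟩ := hlin.exists_weight Vmax
  set σ := 2 * |Vmax| + 1 with hσ
  have hσ0 : 0 < σ := by positivity
  have hσV : 2 * Vmax ≤ σ := by linarith [le_abs_self Vmax]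
  obtain ⟨b₀, hb₀, hpot⟩ := exists_potential_le_log d (L := L) hσ0 hlam
  have hlog2 : 0 < Real.log 2 := Real.log_pos one_lt_two
  set Q₀ := 2 * (b₀ / ξ) + 2 * (lam * (d * K ^ 2)) / Real.log 2 with hQ₀
  have hQ₀pos : 0 < Q₀ := by positivity
  -- `Q₀ * log (N + 2)` bounds the squared norm of `S - lam w`; dividing by `log 2` cancels the `log
  -- 2` in the lower bound for `u'`.
  refine ⟨√(Q₀ / Real.log 2), by positivity, fun N η hη ε hε => ?_⟩
  set ℓ := Real.log (N + 2) with hℓdef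
  have hℓ : Real.log 2 ≤ ℓ :=
    Real.log_le_log two_pos (by linarith [(Nat.cast_nonneg N : (0 : ℝ) ≤ N)])
  have hℓ0 : 0 < ℓ := hlog2.trans_le hℓ
  have hQ : 2 * (b₀ * ℓ / ξ) + 2 * (lam * (d * K ^ 2)) ≤ Q₀ * ℓ := by
    have h1 : 2 * (lam * (d * K ^ 2)) ≤ 2 * (lam * (d * K ^ 2)) / Real.log 2 * ℓ := by
      rw [div_mul_eq_mul_div, le_div_iff₀ hlog2]
      exact mul_le_mul_of_nonneg_left hℓ (by positivity)
    calc 2 * (b₀ * ℓ / ξ) + 2 * (lam * (d * K ^ 2))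
        ≤ 2 * (b₀ * ℓ / ξ) + 2 * (lam * (d * K ^ 2)) / Real.log 2 * ℓ := add_le_add_right h1 _
      _ = Q₀ * ℓ := by rw [hQ₀]; ring
  -- The feature discrepancy is amplified by `√(d / lam) * √(Q₀ * ℓ)`, which grows with `N`; hence
  -- the grid threshold depends on `N` and `ε`.
  set δ := ε / (√(d / lam) * √(Q₀ * ℓ) + 1) with hδ
  have hδ0 : 0 < δ := by positivity
  have hδε : √(d * δ ^ 2 / lam) * √(Q₀ * ℓ) ≤ ε := by
    have h1 : √(d * δ ^ 2 / lam) = δ * √(d / lam) := by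
      rw [mul_div_right_comm, Real.sqrt_mul (by positivity), Real.sqrt_sq hδ0.le, mul_comm]
    rw [h1, mul_assoc, hδ, div_mul_eq_mul_div, div_le_iff₀ (by positivity)]
    linarith
  obtain ⟨α₀, hα₀⟩ := exists_grid_features_close hS hA hφ hη hδ0
  refine ⟨α₀, fun α hα hα1 => ?_⟩
  obtain ⟨m₀, hm₀⟩ := hα₀ α hα hα1
  refine ⟨m₀, fun m hm T hT μ hμ hcomp V hV hVb x => ?_⟩
  obtain ⟨w, hwK, hw⟩ := hK V hV hVb
  -- The good event involves only the noise, neither `x` nor the grid; the rest of the argument is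
  -- deterministic on it.
  refine (selfNormalized_noise_prob hcomp hV hVb hσV hφ.continuous.measurable hL hlam
    (mul_pos hb₀ hℓ0) (hpot N) hξ).trans (measure_mono fun D hD => ?_)
  rw [Set.mem_ofPred_eq] at hD ⊢
  beta_reduce
  have hC : 0 < √(Q₀ / Real.log 2) * √ℓ := by positivity
  rcases eq_or_ne (M.pseudoCount α m η D x) 0 with h0 | h0
  · rw [gpcUncertainty_eq_top hT h0, ENNReal.mul_top (ENNReal.ofReal_pos.2 hC).ne', top_add]
    exact le_top
  have hJ : (Finset.univ.filter fun i : Fin N =>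
      M.gridCell α m η D (D i).1 = M.gridCell α m η D x).Nonempty :=
    Finset.card_ne_zero.1 h0
  have herr := abs_empBellman_sub_bellman_le_of_close hlam hw hwK D x hJ (δ := δ)
    (fun i hi => hm₀ m hm N D x i (Finset.mem_filter.1 hi).2) hD
  change _ ≤ (√(1 / M.pseudoCount α m η D x) + _) * _ at herr
  refine le_trans ?_ (add_le_add_left
    (mul_le_mul_right (ofReal_sqrt_le_gpcUncertainty hT h0) _) _)
  rw [← ENNReal.ofReal_mul hC.le, ← ENNReal.ofReal_add (by positivity) hε.le]
  refine ENNReal.ofReal_le_ofReal (herr.trans ?_)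
  have hmain : √(Q₀ / Real.log 2) * √ℓ * √(Real.log 2 / M.pseudoCount α m η D x) =
      √(1 / M.pseudoCount α m η D x) * √(Q₀ * ℓ) := by
    rw [← Real.sqrt_mul (by positivity), ← Real.sqrt_mul (by positivity),
      ← Real.sqrt_mul (by positivity)]
    congr 1
    field_simp
  rw [hmain, add_mul]
  have hQs := Real.sqrt_le_sqrt hQ
  exact add_le_add (mul_le_mul_of_nonneg_left hQs (Real.sqrt_nonneg _))
    ((mul_le_mul_of_nonneg_left hQs (Real.sqrt_nonneg _)).trans hδε)

end MDP

end

theorem theorem1 {n₁ n₂ d : ℕ} (M : MDP n₁ n₂)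
    (hS : Bornology.IsBounded M.S) (hA : Bornology.IsBounded M.A)
    (φ : M.S × M.A → Fin d → ℝ) (hlin : M.IsLinear φ) (hφ : UniformContinuous φ)
    (lam : ℝ) (hlam : 0 < lam) (ξ : ℝ) (hξ : ξ ∈ Set.Ioc (0 : ℝ) 1) (Vmax : ℝ) :
    (∀ N : ℕ, ∃ c : ℝ, 0 < c ∧
      ∀ (α : ℕ) (m η : ℝ) (T : ℕ), 1 ≤ α → 1 ≤ m → 0 ≤ η → 2 ≤ T →
      ∀ μ : Measure (M.Dataset N), IsProbabilityMeasure μ → M.IsCompliant μ →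
      ∀ V : M.S → ℝ, Measurable V → (∀ s, |V s| ≤ Vmax) →
        M.IsUncertaintyQuantifier φ lam V μ ξ
          (fun D x => ENNReal.ofReal c * M.gpcUncertainty α m η T D x)) ∧
    (∃ C : ℝ, 0 < C ∧
      ∀ N : ℕ, ∀ η : ℝ, 0 < η → ∀ ε : ℝ, 0 < ε →
      ∃ α₀ : ℕ, ∀ α : ℕ, α₀ ≤ α → 1 ≤ α →
      ∃ m₀ : ℝ, ∀ m : ℝ, m₀ ≤ m → 1 ≤ m →
      ∀ T : ℕ, 2 ≤ T →
      ∀ μ : Measure (M.Dataset N), IsProbabilityMeasure μ → M.IsCompliant μ →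
      ∀ V : M.S → ℝ, Measurable V → (∀ s, |V s| ≤ Vmax) →
        M.IsUncertaintyQuantifier φ lam V μ ξ
          (fun D x => ENNReal.ofReal (C * Real.sqrt (Real.log (N + 2))) *
            M.gpcUncertainty α m η T D x + ENNReal.ofReal ε)) := by

  obtain ⟨L, -, hL⟩ := exists_bound_of_uniformContinuous hS hA hφ
  refine ⟨fun N => ?_, ?_⟩
  · obtain ⟨c, hc, h⟩ := MDP.exists_uncertaintyQuantifier_of_size hlin hL hlam hξ.1.le Vmax N
    exact ⟨c, hc, fun α m η T _ _ _ hT μ hμ _ V hV hVb => h α m η T hT μ hμ V hV hVb⟩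
  · obtain ⟨C, hC, h⟩ :=
      MDP.exists_uncertaintyQuantifier_of_fine_grid hS hA hlin hφ hL hlam hξ.1 Vmax
    refine ⟨C, hC, fun N η hη ε hε => ?_⟩
    obtain ⟨α₀, hα₀⟩ := h N η hη ε hε
    refine ⟨α₀, fun α hα hα1 => ?_⟩
    obtain ⟨m₀, hm₀⟩ := hα₀ α hα hα1
    exact ⟨m₀, fun m hm _ T hT μ hμ hcomp V hV hVb => hm₀ m hm T hT μ hμ hcomp V hV hVb⟩
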